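/- Let $G$ be a group. A $G$-automaton over a finite alphabet $\Sigma$ is a nondeterministic finite automaton with $\varepsilon$-moves, given by a finite state set $Q$, an initial state $q_0\in Q$, a set $Q_a\subseteq Q$ of accepting states, and a transition function assigning to each $(q,\sigma)\in Q\times(\Sigma\cup\{\varepsilon\})$ a finite set of pairs in $Q\times G$, together with a register holding an element of $G$, initially the neutral element. A transition $(q',m)\in\delta(q,\sigma)$ reads $\sigma$, moves from $q$ to $q'$ and replaces the register content $x$ by $xm$. A word is accepted if some computation from $q_0$ that reads the whole word ends in an accepting state with the neutral element in the register. Let $\mathfrak{L}(G)$ be the class of all languages, over finite alphabets, recognized by $G$-automata. Let $\mathbf{H}$ be the discrete Heisenberg group, realized as the subgroup of $SL(3,\mathbb{Z})$ generated by $$a=\begin{pmatrix}1&1&0\\0&1&0\\0&0&1\end{pmatrix},\qquad b=\begin{pmatrix}1&0&0\\0&1&1\\0&0&1\end{pmatrix}.$$ **Theorem.** $\mathfrak{L}(\mathbb{Z}^2)\subsetneq\mathfrak{L}(\mathbf{H})$. -/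

import Mathlib

/-- A group automaton over the group `G`: a nondeterministic finite automaton with input alphabet
`A`, finite state set `Q`, `ε`-moves (the letter `none`), and a register holding an element of `G`.
A transition `(q', m) ∈ δ q s` moves from `q` to `q'`, reads `s`, and multiplies the register by
`m` on the right. There are finitely many transitions. -/
structure GroupAutomaton (G : Type) (A : Type) (Q : Type) where
  δ : Q → Option A → Set (Q × G)
  finite_δ : ∀ q s, (δ q s).Finite
  start : Q
  accept : Set Q

namespace GroupAutomaton

/-- `M.Reach q x w`: the automaton has a computation that starts in the start state with register
`1`, reads exactly the word `w`, and ends in the state `q` with register content `x`. -/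
inductive Reach {G A Q : Type} [Group G] (M : GroupAutomaton G A Q) : Q → G → List A → Prop
  | init : Reach M M.start 1 []
  | eps {q q' : Q} {x m : G} {w : List A} :
      Reach M q x w → (q', m) ∈ M.δ q none → Reach M q' (x * m) w
  | read {q q' : Q} {x m : G} {w : List A} {a : A} :
      Reach M q x w → (q', m) ∈ M.δ q (some a) → Reach M q' (x * m) (w ++ [a])

/-- The recognized language: the words after which an accepting state can be reached with the
neutral element in the register. -/
def language {G A Q : Type} [Group G] (M : GroupAutomaton G A Q) : Language A :=
  {w | ∃ q ∈ M.accept, M.Reach q 1 w}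

end GroupAutomaton

/-- A language together with its finite alphabet. -/
abbrev FiniteAlphabetLanguage : Type 1 := Σ A : {A : Type // Finite A}, Language A.1

/-- The class of all languages, over all finite alphabets, that are recognized by automata over the
group `G`. -/
def automatonLanguages (G : Type) [Group G] : Set FiniteAlphabetLanguage :=
  {L | ∃ (Q : Type) (_ : Finite Q) (M : GroupAutomaton G L.1.1 Q), M.language = L.2}

/-- The matrix `a = I + E₁₂`. -/
def heisenbergA : Matrix.SpecialLinearGroup (Fin 3) ℤ :=
  ⟨!![1, 1, 0; 0, 1, 0; 0, 0, 1], by simp [Matrix.det_fin_three]⟩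

/-- The matrix `b = I + E₂₃`. -/
def heisenbergB : Matrix.SpecialLinearGroup (Fin 3) ℤ :=
  ⟨!![1, 0, 0; 0, 1, 1; 0, 0, 1], by simp [Matrix.det_fin_three]⟩

/-- The discrete Heisenberg group, as the subgroup of `SL(3, ℤ)` generated by `a` and `b`. -/
def discreteHeisenberg : Subgroup (Matrix.SpecialLinearGroup (Fin 3) ℤ) :=
  Subgroup.closure {heisenbergA, heisenbergB}

/-! The group ℤ² embeds in the Heisenberg group, and pushing register operations through an
injective homomorphism preserves the language; this gives the inclusion.

Strictness is witnessed by the unary words of triangular length. Over a commutative group a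
computation matters only through the total of its effects in `G × ℕ` (register change, letters
read). By Kleene's recursion these totals form a semilinear set; restricting to register zero and
projecting, the accepted lengths are semilinear (`isSemilinearSet_length_image`). Triangular numbers
are not, since their gaps grow. In the Heisenberg group, however, the powers of `(1, 1, 0)` are `(n,
n, n.choose 2)`, so the corner entry produces triangular numbers
(`triangularAutomaton.language_eq`). -/

open scoped Pointwise

/-! ### Semilinearity of path weights -/

/-- `EdgePath E S p q v`: there is a nonempty path from `p` to `q` of total weight `v`, along edges
whose weights are taken from `E`, all of whose intermediate vertices lie in `S`. -/
inductive EdgePath {Q M : Type} [AddCommMonoid M] (E : Q → Q → Set M) (S : Set Q) :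
    Q → Q → M → Prop
  | edge {p q : Q} {v : M} : v ∈ E p q → EdgePath E S p q v
  | snoc {p s q : Q} {u v : M} :
      EdgePath E S p s u → s ∈ S → v ∈ E s q → EdgePath E S p q (u + v)

namespace EdgePath

variable {Q M : Type} [AddCommMonoid M] {E : Q → Q → Set M} {S T : Set Q} {p q s : Q} {u v : M}

theorem mono (hST : S ⊆ T) (h : EdgePath E S p q u) : EdgePath E T p q u := by
  induction h with
  | edge h => exact .edge h
  | snoc _ hs hv ih => exact .snoc ih (hST hs) hv

theorem trans (h₁ : EdgePath E S p s u) (hs : s ∈ S) (h₂ : EdgePath E S s q v) :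
    EdgePath E S p q (u + v) := by
  induction h₂ with
  | edge h => exact .snoc h₁ hs h
  | snoc _ hr hv ih =>
    rw [← add_assoc]
    exact .snoc ih hr hv

theorem trans_closure (h : EdgePath E S p s u) (hs : s ∈ S)
    (hv : v ∈ AddSubmonoid.closure {v | EdgePath E S s s v}) : EdgePath E S p s (u + v) := by
  induction hv using AddSubmonoid.closure_induction generalizing u with
  | mem v hv => exact h.trans hs hv
  | zero => rwa [add_zero]
  | add v w _ _ ihv ihw =>
    rw [← add_assoc]
    exact ihw (ihv h)

/-- Kleene's recursion for the weights of paths, on the set of allowed intermediate vertices. -/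
theorem setOf_insert (E : Q → Q → Set M) (S : Set Q) (p s q : Q) :
    {v | EdgePath E (insert s S) p q v} = {v | EdgePath E S p q v} ∪
      ({v | EdgePath E S p s v} + (AddSubmonoid.closure {v | EdgePath E S s s v} : Set M) +
        {v | EdgePath E S s q v}) := by
  apply subset_antisymm
  · intro v hv
    induction hv with
    | edge h => exact Or.inl (.edge h)
    | @snoc r q u v _ hr hv ih =>
      -- Either the path so far avoids `s`, or it splits at its first and last visits to `s`. If the
      -- new intermediate vertex `r` is `s`, the last segment ends there: it becomes the initial
      -- segment in the first case and one more loop in the second.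
      rcases ih with ih | ⟨_, ⟨x, hx, y, hy, rfl⟩, z, hz, rfl⟩
      · rcases hr with rfl | hr
        · exact Or.inr ⟨_, ⟨u, ih, 0, zero_mem _, add_zero u⟩, v, .edge hv, rfl⟩
        · exact Or.inl (.snoc ih hr hv)
      · rcases hr with rfl | hr
        · exact Or.inr ⟨_, ⟨x, hx, _, add_mem hy (AddSubmonoid.subset_closure hz), rfl⟩, v,
            .edge hv, by simp only [add_assoc]⟩
        · exact Or.inr ⟨_, ⟨x, hx, y, hy, rfl⟩, z + v, .snoc hz hr hv, by
            simp only [add_assoc]⟩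
  · rintro _ (h | ⟨_, ⟨x, hx, y, hy, rfl⟩, z, hz, rfl⟩)
    · exact h.mono (Set.subset_insert _ _)
    · have hS : S ⊆ insert s S := Set.subset_insert _ _
      exact ((hx.mono hS).trans_closure (Set.mem_insert _ _)
        (AddSubmonoid.closure_mono (fun _ h => h.mono hS) hy)).trans (Set.mem_insert _ _)
          (hz.mono hS)

/-- In a finite graph with finitely many edges, the weights of the paths between two vertices form
a semilinear set. -/
theorem isSemilinearSet [Finite Q] (hE : ∀ p q, (E p q).Finite) (S : Set Q) (p q : Q) :
    IsSemilinearSet {v | EdgePath E S p q v} := by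
  induction S, S.toFinite using Set.Finite.induction_on generalizing p q with
  | empty =>
    have : {v | EdgePath E ∅ p q v} = E p q := by
      ext v
      refine ⟨fun h => ?_, .edge⟩
      cases h with
      | edge h => exact h
      | snoc _ hs _ => exact hs.elim
    rw [this]
    exact .of_finite (hE p q)
  | @insert s S _ _ ih =>
    rw [setOf_insert]
    -- Commutativity matters here: the submonoid generated by a semilinear set is again semilinear.
    exact (ih p q).union (((ih p s).add (ih s s).closure).add (ih s q))

end EdgePath

/-! ### Change of group, and accepted lengths over commutative groups -/

namespace GroupAutomaton

variable {A G K Q : Type}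

section Map

variable [Group G] [Group K]

/-- The automaton obtained by applying a homomorphism to all register operations. -/
def map (M : GroupAutomaton G A Q) (f : G →* K) : GroupAutomaton K A Q where
  δ q s := Prod.map id f '' M.δ q s
  finite_δ q s := (M.finite_δ q s).image _
  start := M.start
  accept := M.accept

theorem reach_map_iff (M : GroupAutomaton G A Q) (f : G →* K) {q : Q} {y : K} {w : List A} :
    (M.map f).Reach q y w ↔ ∃ x, f x = y ∧ M.Reach q x w := by
  constructor
  · intro h
    induction h with
    | init => exact ⟨1, map_one f, .init⟩
    | eps _ hm ih =>
      obtain ⟨x, rfl, hx⟩ := ih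
      obtain ⟨⟨r, m⟩, hm, he⟩ := hm
      cases he
      exact ⟨x * m, map_mul f x m, hx.eps hm⟩
    | read _ hm ih =>
      obtain ⟨x, rfl, hx⟩ := ih
      obtain ⟨⟨r, m⟩, hm, he⟩ := hm
      cases he
      exact ⟨x * m, map_mul f x m, hx.read hm⟩
  · rintro ⟨x, rfl, h⟩
    induction h with
    | init =>
      rw [map_one]
      exact .init
    | eps _ hm ih =>
      rw [map_mul]
      exact ih.eps ⟨_, hm, rfl⟩
    | read _ hm ih =>
      rw [map_mul]
      exact ih.read ⟨_, hm, rfl⟩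

theorem language_map (M : GroupAutomaton G A Q) {f : G →* K} (hf : Function.Injective f) :
    (M.map f).language = M.language := by
  ext w
  refine exists_congr fun q => and_congr_right fun _ => ?_
  rw [reach_map_iff]
  constructor
  · rintro ⟨x, hx, h⟩
    rwa [(map_eq_one_iff f hf).1 hx] at h
  · exact fun h => ⟨1, map_one f, h⟩

end Map

section Commutative

variable (M : GroupAutomaton (Multiplicative G) A Q)

/-- The effects of the transitions from `p` to `q`: the change of the register together with the
number of letters read. -/
def effects (p q : Q) : Set (G × ℕ) :=
  (fun m => (m.toAdd, 0)) '' {m | (q, m) ∈ M.δ p none} ∪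
    ⋃ a : A, (fun m => (m.toAdd, 1)) '' {m | (q, m) ∈ M.δ p (some a)}

theorem finite_effects [Finite A] (p q : Q) : (M.effects p q).Finite :=
  have h (s : Option A) : {m | (q, m) ∈ M.δ p s}.Finite :=
    (M.finite_δ p s).preimage (Prod.mk_right_injective q).injOn
  ((h none).image _).union (Set.finite_iUnion fun a => (h (some a)).image _)

variable [AddCommGroup G]

/-- The first alternative is the computation without transitions, since an `EdgePath` has at least
one edge. -/
theorem exists_reach_iff (q : Q) (v : G × ℕ) :
    (∃ w : List A, M.Reach q (Multiplicative.ofAdd v.1) w ∧ w.length = v.2) ↔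
      (q = M.start ∧ v = 0) ∨ EdgePath M.effects Set.univ M.start q v := by
  constructor
  · have key {x : Multiplicative G} {w : List A} (h : M.Reach q x w) :
        (q = M.start ∧ (x.toAdd, w.length) = 0) ∨
          EdgePath M.effects Set.univ M.start q (x.toAdd, w.length) := by
      have step {p q : Q} {v e : G × ℕ} (he : e ∈ M.effects p q) (h : (p = M.start ∧ v = 0) ∨
          EdgePath M.effects Set.univ M.start p v) :
          EdgePath M.effects Set.univ M.start q (v + e) := by
        rcases h with ⟨rfl, rfl⟩ | h
        · rw [zero_add]
          exact .edge he
        · exact h.snoc (Set.mem_univ _) he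
      induction h with
      | init => exact Or.inl ⟨rfl, rfl⟩
      | eps _ hm ih => exact Or.inr (step (Or.inl ⟨_, hm, rfl⟩) ih)
      | read _ hm ih =>
        right
        rw [List.length_append]
        exact step (Or.inr (Set.mem_iUnion.2 ⟨_, _, hm, rfl⟩)) ih
    rintro ⟨w, h, hw⟩
    have := key h
    rwa [hw] at this
  · have step {p q : Q} {v e : G × ℕ} (he : e ∈ M.effects p q)
        (h : ∃ w : List A, M.Reach p (Multiplicative.ofAdd v.1) w ∧ w.length = v.2) :
        ∃ w : List A, M.Reach q (Multiplicative.ofAdd (v + e).1) w ∧ w.length = (v + e).2 := by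
      obtain ⟨w, h, hw⟩ := h
      rcases he with ⟨m, hm, rfl⟩ | he
      · exact ⟨w, h.eps hm, hw⟩
      · obtain ⟨a, m, hm, rfl⟩ := Set.mem_iUnion.1 he
        exact ⟨w ++ [a], h.read hm, by simp [hw]⟩
    rintro (⟨rfl, rfl⟩ | h)
    · exact ⟨[], .init, rfl⟩
    · generalize hs : M.start = s at h
      induction h with
      | edge he =>
        subst hs
        simpa only [zero_add] using step (v := 0) he ⟨[], .init, rfl⟩
      | snoc _ _ he ih => exact step he ih

/-- The lengths of the words accepted by an automaton over a commutative group form a semilinear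
set. -/
theorem isSemilinearSet_length_image [Finite A] [Finite Q] :
    IsSemilinearSet (List.length '' (M.language : Set (List A))) := by
  have hreach (q : Q) : IsSemilinearSet {v : G × ℕ |
      ∃ w : List A, M.Reach q (Multiplicative.ofAdd v.1) w ∧ w.length = v.2} := by
    simp only [exists_reach_iff]
    refine IsSemilinearSet.union (.of_finite ?_) (EdgePath.isSemilinearSet M.finite_effects _ _ _)
    exact (Set.finite_singleton (0 : G × ℕ)).subset fun v hv => hv.2
  -- As a copy of ℕ this set is semilinear even if `G` is not finitely generated.
  have hzero : IsSemilinearSet {v : G × ℕ | v.1 = 0} := by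
    convert (IsSemilinearSet.univ (M := ℕ)).image (AddMonoidHom.inr G ℕ) using 1
    ext ⟨x, n⟩
    simp [eq_comm]
  have himage : List.length '' (M.language : Set (List A)) = ⋃ q ∈ M.accept,
      AddMonoidHom.snd G ℕ '' ({v : G × ℕ | ∃ w : List A,
        M.Reach q (Multiplicative.ofAdd v.1) w ∧ w.length = v.2} ∩ {v : G × ℕ | v.1 = 0}) := by
    ext n
    simp only [Set.mem_image, Set.mem_iUnion]
    constructor
    · rintro ⟨w, ⟨q, hq, h⟩, rfl⟩
      exact ⟨q, hq, (0, w.length), ⟨⟨w, h, rfl⟩, rfl⟩, rfl⟩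
    · rintro ⟨q, hq, ⟨x, n⟩, ⟨⟨w, h, hw⟩, hx⟩, rfl⟩
      obtain rfl : x = 0 := hx
      exact ⟨w, ⟨q, hq, h⟩, hw⟩
  rw [himage]
  exact .biUnion M.accept.toFinite fun q _ => ((hreach q).inter hzero).image _

end Commutative

end GroupAutomaton

/-! ### Triangular numbers are not semilinear -/

/-- The words whose length is a triangular number. -/
def triangularLanguage (A : Type) : Language A :=
  {w | ∃ n : ℕ, w.length = n.choose 2}

theorem not_isSemilinearSet_triangular :
    ¬ IsSemilinearSet (Set.range fun n : ℕ => n.choose 2) := by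
  rw [Nat.isSemilinearSet_iff_ultimately_periodic]
  rintro ⟨k, p, hp, h⟩
  -- Large enough that `n.choose 2` lies beyond the threshold `k` and the gap `n` to the next
  -- triangular number exceeds `p`; then `n.choose 2 + p` falls strictly between two consecutive
  -- ones.
  set n := k + p + 2 with hn
  have hsucc (m : ℕ) : (m + 1).choose 2 = m + m.choose 2 := by
    rw [Nat.choose_succ_succ' m 1, Nat.choose_one_right]
  have hk : k ≤ n.choose 2 := by
    have := hsucc (k + p + 1)
    rw [← hn] at this
    omega
  obtain ⟨m, hm⟩ := (h _ hk).1 ⟨n, rfl⟩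
  have hnext := hsucc n
  rcases le_or_gt m n with hmn | hmn
  · have := Nat.choose_le_choose 2 hmn
    simp only at hm
    omega
  · have := Nat.choose_le_choose 2 (Nat.succ_le_of_lt hmn)
    simp only [Nat.succ_eq_add_one] at hm this
    omega

theorem language_ne_triangularLanguage {A G Q : Type} [Finite A] [Nonempty A] [Finite Q]
    [AddCommGroup G] (M : GroupAutomaton (Multiplicative G) A Q) :
    M.language ≠ triangularLanguage A := by
  intro h
  apply not_isSemilinearSet_triangular
  convert M.isSemilinearSet_length_image
  rw [h]
  ext l
  constructor
  · rintro ⟨n, rfl⟩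
    exact ⟨List.replicate (n.choose 2) (Classical.arbitrary A), ⟨n, List.length_replicate⟩,
      List.length_replicate⟩
  · rintro ⟨w, ⟨n, hn⟩, rfl⟩
    exact ⟨n, hn.symm⟩

/-! ### Coordinates on the Heisenberg group -/

/-- The upper unitriangular matrix with entries `x`, `y` above the diagonal and `z` in the
corner. -/
def unitriangular (x y z : ℤ) : Matrix.SpecialLinearGroup (Fin 3) ℤ :=
  ⟨!![1, x, z; 0, 1, y; 0, 0, 1], by simp [Matrix.det_fin_three]⟩

theorem unitriangular_mul (x y z x' y' z' : ℤ) :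
    unitriangular x y z * unitriangular x' y' z' =
      unitriangular (x + x') (y + y') (z + z' + x * y') := by
  apply Subtype.ext
  rw [Matrix.SpecialLinearGroup.coe_mul]
  ext i j
  fin_cases i <;> fin_cases j <;>
    simp [unitriangular, Matrix.mul_apply, Fin.sum_univ_three, add_comm, add_assoc]

theorem unitriangular_zero : unitriangular 0 0 0 = 1 := by
  ext i j
  fin_cases i <;> fin_cases j <;> simp [unitriangular]

theorem unitriangular_injective {x y z x' y' z' : ℤ}
    (h : unitriangular x y z = unitriangular x' y' z') : x = x' ∧ y = y' ∧ z = z' := by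
  have h' (i j : Fin 3) := congrArg (fun m => m.1 i j) h
  exact ⟨h' 0 1, h' 1 2, h' 0 2⟩

theorem heisenbergA_zpow (x : ℤ) : heisenbergA ^ x = unitriangular x 0 0 := by
  have h1 : heisenbergA = unitriangular 1 0 0 := rfl
  induction x using Int.induction_on with
  | zero => rw [zpow_zero, unitriangular_zero]
  | succ n ih => rw [zpow_add_one, ih, h1, unitriangular_mul]; simp
  | pred n ih =>
    rw [zpow_sub_one, ih, mul_inv_eq_iff_eq_mul, h1, unitriangular_mul]
    simp

theorem heisenbergB_zpow (y : ℤ) : heisenbergB ^ y = unitriangular 0 y 0 := by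
  have h1 : heisenbergB = unitriangular 0 1 0 := rfl
  induction y using Int.induction_on with
  | zero => rw [zpow_zero, unitriangular_zero]
  | succ n ih => rw [zpow_add_one, ih, h1, unitriangular_mul]; simp
  | pred n ih =>
    rw [zpow_sub_one, ih, mul_inv_eq_iff_eq_mul, h1, unitriangular_mul]
    simp

theorem unitriangular_mem_discreteHeisenberg (x y z : ℤ) :
    unitriangular x y z ∈ discreteHeisenberg := by
  have ha (x : ℤ) : unitriangular x 0 0 ∈ discreteHeisenberg :=
    heisenbergA_zpow x ▸ zpow_mem (Subgroup.subset_closure (by simp)) x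
  have hb (y : ℤ) : unitriangular 0 y 0 ∈ discreteHeisenberg :=
    heisenbergB_zpow y ▸ zpow_mem (Subgroup.subset_closure (by simp)) y
  -- This is `b ^ y * a ^ x` times the commutator of `a` and `b ^ z`, which is central with corner
  -- entry `z`.
  have h : unitriangular x y z = unitriangular 0 y 0 * unitriangular (x + 1) 0 0 *
      unitriangular 0 z 0 * unitriangular (-1) 0 0 * unitriangular 0 (-z) 0 := by
    simp only [unitriangular_mul]
    congr 1 <;> ring
  rw [h]
  exact mul_mem (mul_mem (mul_mem (mul_mem (hb _) (ha _)) (hb _)) (ha _)) (hb _)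

/-- The element of the discrete Heisenberg group with coordinates `x`, `y`, `z`. -/
def heisenbergElement (x y z : ℤ) : discreteHeisenberg :=
  ⟨unitriangular x y z, unitriangular_mem_discreteHeisenberg x y z⟩

theorem heisenbergElement_mul (x y z x' y' z' : ℤ) :
    heisenbergElement x y z * heisenbergElement x' y' z' =
      heisenbergElement (x + x') (y + y') (z + z' + x * y') :=
  Subtype.ext (unitriangular_mul x y z x' y' z')

theorem heisenbergElement_zero : heisenbergElement 0 0 0 = 1 :=
  Subtype.ext unitriangular_zero

theorem heisenbergElement_injective {x y z x' y' z' : ℤ}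
    (h : heisenbergElement x y z = heisenbergElement x' y' z') : x = x' ∧ y = y' ∧ z = z' :=
  unitriangular_injective (congrArg Subtype.val h)

/-- The embedding of `ℤ²` into the discrete Heisenberg group as a coordinate plane. -/
def planeToHeisenberg : Multiplicative (Fin 2 → ℤ) →* discreteHeisenberg where
  toFun v := heisenbergElement (v.toAdd 0) 0 (v.toAdd 1)
  map_one' := heisenbergElement_zero
  -- The twist `x * y'` vanishes on the plane `y = 0`.
  map_mul' v w := by simp [heisenbergElement_mul]

theorem planeToHeisenberg_injective : Function.Injective planeToHeisenberg := by
  intro v w h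
  obtain ⟨h0, -, h1⟩ := heisenbergElement_injective h
  apply Multiplicative.toAdd.injective
  ext i
  fin_cases i
  exacts [h0, h1]

/-! ### A Heisenberg automaton for triangular lengths -/

/-- An automaton over the discrete Heisenberg group. In state `0` it multiplies the register by
`(1, 1, 0)`, reaching `(n, n, n.choose 2)`; in state `1` it clears the first coordinate; in state
`2` it clears the second one and decreases the third one with each letter read. -/
def triangularAutomaton (A : Type) : GroupAutomaton discreteHeisenberg A (Fin 3) where
  δ q s := match q, s with
    | 0, none => {(0, heisenbergElement 1 1 0), (1, 1)}
    | 1, none => {(1, heisenbergElement (-1) 0 0), (2, 1)}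
    | 2, none => {(2, heisenbergElement 0 (-1) 0)}
    | 2, some _ => {(2, heisenbergElement 0 0 (-1))}
    | _, _ => ∅
  finite_δ q s := by split <;> simp
  start := 0
  accept := {2}

namespace triangularAutomaton

variable {A : Type}

/-- The configurations of the automaton: here `n`, `k`, `l` count the multiplications performed in
the states `0`, `1`, `2`, and `r` is the number of letters read. -/
def Invariant (q : Fin 3) (X : discreteHeisenberg) (r : ℕ) : Prop :=
  ∃ n k l : ℕ, (q = 0 → k = 0) ∧ (q ≠ 2 → l = 0 ∧ r = 0) ∧
    X = heisenbergElement (n - k) (n - l) (n.choose 2 - l * (n - k) - r)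

theorem invariant_of_reach {q : Fin 3} {X : discreteHeisenberg} {w : List A}
    (h : (triangularAutomaton A).Reach q X w) : Invariant q X w.length := by
  induction h with
  | init => exact ⟨0, 0, 0, by simp [heisenbergElement_zero]⟩
  | @eps q q' X m w _ hm ih =>
    obtain ⟨n, k, l, hk, hl, rfl⟩ := ih
    fin_cases q
    · obtain rfl := hk rfl
      obtain ⟨rfl, hr⟩ := hl (by decide)
      rcases hm with hm | hm <;> cases hm
      · refine ⟨n + 1, 0, 0, fun _ => rfl, fun _ => ⟨rfl, hr⟩, ?_⟩
        rw [heisenbergElement_mul]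
        congr 1
        push_cast [Nat.choose_succ_succ' n 1, Nat.choose_one_right]
        ring
      · exact ⟨n, 0, 0, fun _ => rfl, fun _ => ⟨rfl, hr⟩, mul_one _⟩
    · obtain ⟨rfl, hr⟩ := hl (by decide)
      rcases hm with hm | hm <;> cases hm
      · refine ⟨n, k + 1, 0, nofun, fun _ => ⟨rfl, hr⟩, ?_⟩
        rw [heisenbergElement_mul]
        congr 1 <;> push_cast <;> ring
      · exact ⟨n, k, 0, nofun, fun _ => ⟨rfl, hr⟩, mul_one _⟩
    · cases hm
      refine ⟨n, k, l + 1, nofun, fun h => (h rfl).elim, ?_⟩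
      rw [heisenbergElement_mul]
      congr 1 <;> push_cast <;> ring
  | @read q q' X m w a _ hm ih =>
    obtain ⟨n, k, l, -, -, rfl⟩ := ih
    fin_cases q
    · exact hm.elim
    · exact hm.elim
    · cases hm
      refine ⟨n, k, l, nofun, fun h => (h rfl).elim, ?_⟩
      rw [heisenbergElement_mul]
      congr 1 <;> push_cast [List.length_append, List.length_singleton] <;> ring

/-- With first coordinate `n`, a further factor `(1, 1, 0)` adds `n` to the corner, so the corner is
`0 + 1 + ⋯ + (n - 1)`. -/
theorem reach_zero (n : ℕ) :
    (triangularAutomaton A).Reach 0 (heisenbergElement n n (n.choose 2)) [] := by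
  induction n with
  | zero => exact heisenbergElement_zero ▸ .init
  | succ n ih =>
    have h := ih.eps (q' := 0) (m := heisenbergElement 1 1 0) (Or.inl rfl)
    rw [heisenbergElement_mul] at h
    convert h using 2 <;> push_cast [Nat.choose_succ_succ' n 1, Nat.choose_one_right] <;> ring

theorem reach_one (n k : ℕ) :
    (triangularAutomaton A).Reach 1 (heisenbergElement (n - k) n (n.choose 2)) [] := by
  induction k with
  | zero => simpa using (reach_zero n).eps (q' := 1) (m := 1) (Or.inr rfl)
  | succ k ih =>
    have h := ih.eps (q' := 1) (m := heisenbergElement (-1) 0 0) (Or.inl rfl)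
    rw [heisenbergElement_mul] at h
    convert h using 2 <;> push_cast <;> ring

/-- The first coordinate is already zero, so clearing the second leaves the corner unchanged. -/
theorem reach_two (n l : ℕ) :
    (triangularAutomaton A).Reach 2 (heisenbergElement 0 (n - l) (n.choose 2)) [] := by
  induction l with
  | zero => simpa using (reach_one n n).eps (q' := 2) (m := 1) (Or.inr rfl)
  | succ l ih =>
    have h := ih.eps (q' := 2) (m := heisenbergElement 0 (-1) 0) rfl
    rw [heisenbergElement_mul] at h
    convert h using 2 <;> push_cast <;> ring

theorem reach_word (n : ℕ) (w : List A) :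
    (triangularAutomaton A).Reach 2 (heisenbergElement 0 0 (n.choose 2 - w.length)) w := by
  induction w using List.reverseRecOn with
  | nil => simpa using reach_two n n
  | append_singleton w a ih =>
    have h := ih.read (q' := 2) (m := heisenbergElement 0 0 (-1)) (a := a) rfl
    rw [heisenbergElement_mul] at h
    simp only [add_zero, mul_zero] at h
    rwa [List.length_append, List.length_singleton, Nat.cast_add, Nat.cast_one, ← sub_sub,
      sub_eq_add_neg _ (1 : ℤ)]

theorem language_eq : (triangularAutomaton A).language = triangularLanguage A := by
  ext w
  constructor
  · rintro ⟨q, rfl, h⟩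
    obtain ⟨n, k, l, -, -, h⟩ := invariant_of_reach h
    obtain ⟨h₁, -, h₃⟩ := heisenbergElement_injective (heisenbergElement_zero.trans h)
    -- Acceptance forces `n = k`, which removes the error term `l * (n - k)` and leaves `r =
    -- n.choose 2`.
    rw [← h₁] at h₃
    exact ⟨n, by omega⟩
  · rintro ⟨n, hn⟩
    refine ⟨2, rfl, ?_⟩
    have h := reach_word n w
    rwa [hn, sub_self, heisenbergElement_zero] at h

end triangularAutomaton

theorem mainTheorem9 :
    automatonLanguages (Multiplicative (Fin 2 → ℤ)) ⊂ automatonLanguages discreteHeisenberg := by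
  rw [Set.ssubset_iff_exists]
  refine ⟨?_, ⟨⟨Unit, inferInstance⟩, triangularLanguage Unit⟩,
    ⟨Fin 3, inferInstance, _, triangularAutomaton.language_eq⟩, ?_⟩
  · rintro L ⟨Q, hQ, M, hM⟩
    exact ⟨Q, hQ, M.map planeToHeisenberg, (M.language_map planeToHeisenberg_injective).trans hM⟩
  · rintro ⟨Q, hQ, M, hM⟩
    exact language_ne_triangularLanguage M hM
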